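/- Proposition 3.6. Let $(S,\mathcal A,\mu)$ be a complete (positive) measure space, let $X$ be a real uniformly convex and uniformly smooth Banach space with dual $X^*$, and let $1<p,q<\infty$ with $\frac1p+\frac1q=1$. Let $L_p(S;X)$ be the Bochner space of $\mu$-equivalence classes of strongly measurable $f:S\to X$ with $\|f\|_{L_p(S;X)}=\left(\int_S\|f(s)\|_X^p\,d\mu(s)\right)^{1/p}<\infty$, and likewise $L_q(S;X^*)$. For $C\subseteq L_p(S;X)$ and $\varphi\in L_q(S;X^*)$ put $$\mathcal S_C(\varphi)=\left\{g\in C:\ \int_S\langle\varphi(s),g(s)\rangle\,d\mu(s)=\sup_{f\in C}\int_S\langle\varphi(s),f(s)\rangle\,d\mu(s)\right\},$$ and for a bounded linear functional $\Phi\in (L_p(S;X))^*$ put $\mathcal S_C(\Phi)=\{g\in C:\ \Phi(g)=\sup_{f\in C}\Phi(f)\}$. If $C$ is a nonempty, closed, convex and bounded subset of $L_p(S;X)$, then for every $\varphi\in L_q(S;X^*)$ the set $\mathcal S_C(\varphi)$ is a nonempty, closed and convex subset of $C$, and for every $\Phi\in (L_p(S;X))^*$ the set $\mathcal S_C(\Phi)$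 is a nonempty, closed and convex subset of $C$. -/

import Mathlib

open MeasureTheory
open scoped ENNReal

/-- A real normed space is *uniformly smooth* if its modulus of smoothness
`ρ(t) = sup {(‖x + y‖ + ‖x - y‖) / 2 - 1 : ‖x‖ = 1, ‖y‖ = t}` satisfies `ρ(t) / t → 0` as
`t → 0⁺`: for all `ε > 0` there is `δ > 0` with `‖x + y‖ + ‖x - y‖ ≤ 2 + ε ‖y‖` whenever
`‖x‖ = 1` and `‖y‖ ≤ δ`. -/
class UniformSmoothSpace (E : Type*) [SeminormedAddCommGroup E] : Prop where
  uniform_smooth : ∀ ⦃ε : ℝ⦄, 0 < ε → ∃ δ, 0 < δ ∧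
    ∀ ⦃x : E⦄, ‖x‖ = 1 → ∀ ⦃y : E⦄, ‖y‖ ≤ δ → ‖x + y‖ + ‖x - y‖ ≤ 2 + ε * ‖y‖

/-- The pairing `⟨φ, f⟩ = ∫ ⟨φ(s), f(s)⟩ dμ(s)` of `φ ∈ L_q(S; X^*)` and `f ∈ L_p(S; X)`.
For conjugate exponents the integrand is integrable, by Hölder's inequality. -/
noncomputable def bochnerPairing {S X : Type*} [MeasurableSpace S] {μ : Measure S}
    [NormedAddCommGroup X] [NormedSpace ℝ X] {p q : ℝ≥0∞}
    (φ : Lp (StrongDual ℝ X) q μ) (f : Lp X p μ) : ℝ :=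
  ∫ s, φ s (f s) ∂μ

/-- The set `S_C(F)` of those `g ∈ C` with `F g = sup_{f ∈ C} F f` (the supremum being a finite,
attained one). -/
def maximizers {E : Type*} (C : Set E) (F : E → ℝ) : Set E :=
  {g | g ∈ C ∧ IsLUB (F '' C) (F g)}

/-- The solution set `S_C(φ)`, for `φ ∈ L_q(S; X^*)` and `C ⊆ L_p(S; X)`. -/
def solutionSet {S X : Type*} [MeasurableSpace S] {μ : Measure S}
    [NormedAddCommGroup X] [NormedSpace ℝ X] {p q : ℝ≥0∞}
    (C : Set (Lp X p μ)) (φ : Lp (StrongDual ℝ X) q μ) : Set (Lp X p μ) :=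
  maximizers C (bochnerPairing φ)

/-! Nonemptiness rests on uniform convexity alone, with no appeal to weak compactness. The space `Lp
X p μ` inherits uniform convexity from `X` (`uniformConvexSpace_Lp`), because a pointwise inequality
between `p`-th powers of norms can be integrated. In a uniformly convex Banach space, nested
nonempty closed convex bounded sets share a point, since almost norm-minimal elements form a Cauchy
sequence. Applied to the slices of `C` where `Φ` is within `1 / (n + 1)` of its supremum, this gives
a maximizer. Closedness and convexity hold because the maximizers are `C` cut by closed half-spaces.
By Hölder, the pairing with `φ` is itself a bounded functional. -/

/-- The gap is positive at each admissible `(t, m)`: by strict convexity of the power if `t < 1`, by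
`m ≤ 1 - η` if `t = 1`. Compactness makes it uniform. -/
theorem exists_pos_le_midpoint_rpow_sub_rpow {p : ℝ} (hp : 1 < p) {η : ℝ} (hη : 0 < η) :
    ∃ c, 0 < c ∧ ∀ t m : ℝ, 0 ≤ t → t ≤ 1 → 0 ≤ m → m ≤ (1 + t) / 2 → m ≤ 1 - η →
      c ≤ (1 + t ^ p) / 2 - m ^ p := by
  have hp0 : 0 < p := by linarith
  set K : Set (ℝ × ℝ) :=
    (Set.Icc 0 1 ×ˢ Set.Icc 0 1) ∩ {z | z.2 ≤ (1 + z.1) / 2} ∩ {z | z.2 ≤ 1 - η} with hK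
  have hKc : IsCompact K := by
    refine ((isCompact_Icc.prod isCompact_Icc).inter_right ?_).inter_right ?_
    · exact isClosed_le (by fun_prop) (by fun_prop)
    · exact isClosed_le (by fun_prop) (by fun_prop)
  have hcont : Continuous fun z : ℝ × ℝ => (1 + z.1 ^ p) / 2 - z.2 ^ p := by
    have h1 : Continuous fun z : ℝ × ℝ => z.1 ^ p :=
      continuous_fst.rpow_const fun _ => Or.inr hp0.le
    have h2 : Continuous fun z : ℝ × ℝ => z.2 ^ p :=
      continuous_snd.rpow_const fun _ => Or.inr hp0.le
    fun_prop
  have hpos : ∀ z ∈ K, 0 < (1 + z.1 ^ p) / 2 - z.2 ^ p := by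
    rintro ⟨t, m⟩ ⟨⟨⟨⟨ht0, ht1⟩, hm0, -⟩, hmt⟩, hmη⟩
    simp only [Set.mem_ofPred_eq] at *
    rcases ht1.eq_or_lt with rfl | ht1
    · have := Real.rpow_lt_one hm0 (by linarith) hp0
      simp only [Real.one_rpow]
      linarith
    · have h1 : m ^ p ≤ ((1 + t) / 2) ^ p := Real.rpow_le_rpow hm0 hmt hp0.le
      have h2 := (strictConvexOn_rpow hp).2 (Set.mem_Ici.2 ht0) (Set.mem_Ici.2 zero_le_one)
        ht1.ne (by norm_num : (0 : ℝ) < 1 / 2) (by norm_num : (0 : ℝ) < 1 / 2) (by norm_num)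
      simp only [smul_eq_mul, Real.one_rpow] at h2
      rw [show (1 / 2 * t + 1 / 2 * 1 : ℝ) = (1 + t) / 2 by ring] at h2
      linarith
  rcases K.eq_empty_or_nonempty with hKe | hKne
  · refine ⟨1, one_pos, fun t m ht0 ht1 hm0 hmt hmη => ?_⟩
    have : (t, m) ∈ K := ⟨⟨⟨⟨ht0, ht1⟩, hm0, by linarith⟩, hmt⟩, hmη⟩
    simp [hKe] at this
  · obtain ⟨z, hz, hmin⟩ := hKc.exists_isMinOn hKne hcont.continuousOn
    refine ⟨_, hpos z hz, fun t m ht0 ht1 hm0 hmt hmη => ?_⟩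
    exact hmin (⟨⟨⟨⟨ht0, ht1⟩, hm0, by linarith⟩, hmt⟩, hmη⟩ : (t, m) ∈ K)

theorem norm_add_rpow_div_two_rpow_le {X : Type*} [SeminormedAddCommGroup X] {p : ℝ}
    (hp : 1 < p) (x y : X) : ‖x + y‖ ^ p / 2 ^ p ≤ (‖x‖ ^ p + ‖y‖ ^ p) / 2 := by
  have h2 := (convexOn_rpow hp.le).2 (Set.mem_Ici.2 (norm_nonneg x))
    (Set.mem_Ici.2 (norm_nonneg y)) (by norm_num : (0 : ℝ) ≤ 1 / 2)
    (by norm_num : (0 : ℝ) ≤ 1 / 2) (by norm_num)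
  simp only [smul_eq_mul] at h2
  rw [← Real.div_rpow (norm_nonneg _) zero_le_two]
  have h1 : (‖x + y‖ / 2) ^ p ≤ (1 / 2 * ‖x‖ + 1 / 2 * ‖y‖) ^ p :=
    Real.rpow_le_rpow (by positivity) (by linarith [norm_add_le x y]) (by linarith)
  linarith

/-! ### Geometry of uniformly convex spaces -/

section UniformlyConvex

variable {X : Type*} [NormedAddCommGroup X] [NormedSpace ℝ X] [UniformConvexSpace X]

/-- In a uniformly convex space the convexity defect of `‖·‖ ^ p` controls `‖x - y‖ ^ p`, up to a
small multiple of `‖x‖ ^ p + ‖y‖ ^ p`. -/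
theorem exists_norm_sub_rpow_le {p : ℝ} (hp : 1 < p) {ε : ℝ} (hε : 0 < ε) :
    ∃ K, 0 < K ∧ ∀ x y : X, ‖x - y‖ ^ p ≤ ε * (‖x‖ ^ p + ‖y‖ ^ p) +
      K * ((‖x‖ ^ p + ‖y‖ ^ p) / 2 - ‖x + y‖ ^ p / 2 ^ p) := by
  have hp0 : 0 < p := by linarith
  have he : 0 < ε ^ p⁻¹ := Real.rpow_pos_of_pos hε _
  obtain ⟨δ, hδ, hconv⟩ := exists_forall_closed_ball_dist_add_le_two_sub X he
  obtain ⟨c, hc, hgap⟩ := exists_pos_le_midpoint_rpow_sub_rpow hp (half_pos hδ)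
  -- For `‖y‖ ≤ ‖x‖ = 1`: if `‖x - y‖ ≤ ε ^ p⁻¹`, the `ε` term suffices; otherwise the defect is at
  -- least `c`, and this factor lifts it to `2 ^ p ≥ ‖x - y‖ ^ p`. Homogeneity and symmetry give the
  -- rest.
  have hK : 0 < 2 ^ p / c := by positivity
  refine ⟨2 ^ p / c, hK, ?_⟩
  have unit : ∀ x y : X, ‖x‖ = 1 → ‖y‖ ≤ 1 → ‖x - y‖ ^ p ≤ ε * (‖x‖ ^ p + ‖y‖ ^ p) +
      2 ^ p / c * ((‖x‖ ^ p + ‖y‖ ^ p) / 2 - ‖x + y‖ ^ p / 2 ^ p) := by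
    intro x y hx hy
    have hD := mul_nonneg hK.le (sub_nonneg.2 (norm_add_rpow_div_two_rpow_le hp x y))
    have hy0 : 0 ≤ ε * ‖y‖ ^ p := by positivity
    rcases le_total (ε ^ p⁻¹) ‖x - y‖ with h | h
    · have h1 := hgap ‖y‖ (‖x + y‖ / 2) (norm_nonneg _) hy (by positivity)
        (by linarith [norm_add_le x y]) (by linarith [hconv hx.le hy h])
      rw [Real.div_rpow (norm_nonneg _) zero_le_two] at h1
      have h2 : ‖x - y‖ ^ p ≤ 2 ^ p :=
        Real.rpow_le_rpow (norm_nonneg _) (by linarith [norm_sub_le x y]) hp0.le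
      have h3 := mul_le_mul_of_nonneg_left h1 hK.le
      rw [div_mul_cancel₀ _ hc.ne'] at h3
      rw [hx, Real.one_rpow]
      linarith
    · have h1 : ‖x - y‖ ^ p ≤ (ε ^ p⁻¹) ^ p := Real.rpow_le_rpow (norm_nonneg _) h hp0.le
      rw [Real.rpow_inv_rpow hε.le hp0.ne'] at h1
      rw [hx, Real.one_rpow] at hD ⊢
      linarith
  have ordered : ∀ x y : X, ‖y‖ ≤ ‖x‖ → ‖x - y‖ ^ p ≤ ε * (‖x‖ ^ p + ‖y‖ ^ p) +
      2 ^ p / c * ((‖x‖ ^ p + ‖y‖ ^ p) / 2 - ‖x + y‖ ^ p / 2 ^ p) := by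
    intro x y hxy
    rcases eq_or_ne x 0 with rfl | hx
    · have : y = 0 := by simpa using hxy
      subst this
      simp [Real.zero_rpow hp0.ne']
    · have hx' : 0 < ‖x‖ := norm_pos_iff.2 hx
      have hscale : ∀ z : X, ‖‖x‖⁻¹ • z‖ ^ p = (‖x‖ ^ p)⁻¹ * ‖z‖ ^ p := fun z => by
        rw [norm_smul, norm_inv, norm_norm, Real.mul_rpow (by positivity) (norm_nonneg _),
          Real.inv_rpow hx'.le]
      have h := unit (‖x‖⁻¹ • x) (‖x‖⁻¹ • y)
        (by rw [norm_smul, norm_inv, norm_norm, inv_mul_cancel₀ hx'.ne'])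
        (by rw [norm_smul, norm_inv, norm_norm, inv_mul_le_one₀ hx']; exact hxy)
      rw [← smul_sub, ← smul_add, hscale, hscale, hscale, hscale] at h
      have hxp : 0 < ‖x‖ ^ p := Real.rpow_pos_of_pos hx' _
      refine le_of_mul_le_mul_left (h.trans_eq ?_) (inv_pos.2 hxp)
      ring
  intro x y
  rcases le_total ‖y‖ ‖x‖ with h | h
  · exact ordered x y h
  · have := ordered y x h
    rwa [norm_sub_rev, add_comm (‖y‖ ^ p), add_comm y] at this

/-- Uniform convexity on a ball whose radius may be slightly exceeded. -/
theorem exists_forall_norm_le_add_norm_add_le (X : Type*) [NormedAddCommGroup X] [NormedSpace ℝ X]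
    [UniformConvexSpace X] {ε : ℝ} (hε : 0 < ε) {r : ℝ} (hr : 0 ≤ r) :
    ∃ δ, 0 < δ ∧ ∀ x y : X, ‖x‖ ≤ r + δ → ‖y‖ ≤ r + δ → ε ≤ ‖x - y‖ → ‖x + y‖ ≤ 2 * (r - δ) := by
  obtain ⟨δ, hδ, h⟩ := exists_forall_closed_ball_dist_add_le_two_mul_sub X (half_pos hε) r
  -- Shrinking by `r / (r + η)` moves each vector by at most `η`: the separation stays at least `ε /
  -- 2`, and the sum is bounded by `2 * r - δ + 2 * η ≤ 2 * (r - η)`.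
  set η := min (ε / 4) (δ / 4) with hη
  have hη0 : 0 < η := by positivity
  have hη1 : η ≤ ε / 4 := min_le_left _ _
  have hη2 : η ≤ δ / 4 := min_le_right _ _
  have hrη : 0 < r + η := by linarith
  refine ⟨η, hη0, fun x y hx hy hxy => ?_⟩
  set a := r / (r + η) with ha
  have ha0 : 0 ≤ a := by positivity
  have ha1 : 0 ≤ 1 - a := by
    rw [ha, sub_nonneg, div_le_one hrη]; linarith
  have har : a * (r + η) = r := div_mul_cancel₀ _ hrη.ne'
  have hball : ∀ z : X, ‖z‖ ≤ r + η → ‖a • z‖ ≤ r ∧ ‖z - a • z‖ ≤ η := by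
    intro z hz
    refine ⟨?_, ?_⟩
    · rw [norm_smul_of_nonneg ha0]
      exact (mul_le_mul_of_nonneg_left hz ha0).trans_eq har
    · have : z - a • z = (1 - a) • z := by rw [sub_smul, one_smul]
      rw [this, norm_smul_of_nonneg ha1]
      refine (mul_le_mul_of_nonneg_left hz ha1).trans_eq ?_
      rw [sub_mul, har]; ring
  obtain ⟨hx1, hx2⟩ := hball x hx
  obtain ⟨hy1, hy2⟩ := hball y hy
  have hsub : ‖x - y‖ ≤ ‖a • x - a • y‖ + (‖x - a • x‖ + ‖y - a • y‖) := by
    rw [show x - y = (a • x - a • y) + ((x - a • x) - (y - a • y)) by abel]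
    exact (norm_add_le _ _).trans (by gcongr; exact norm_sub_le _ _)
  have hadd : ‖x + y‖ ≤ ‖a • x + a • y‖ + (‖x - a • x‖ + ‖y - a • y‖) := by
    rw [show x + y = (a • x + a • y) + ((x - a • x) + (y - a • y)) by abel]
    exact (norm_add_le _ _).trans (by gcongr; exact norm_add_le _ _)
  have := h hx1 hy1 (by linarith)
  linarith

/-- A decreasing sequence of nonempty, closed, convex and bounded subsets of a uniformly convex
Banach space has nonempty intersection. -/
theorem nonempty_iInter_of_antitone_of_convex [CompleteSpace X] {C : ℕ → Set X}
    (hanti : Antitone C) (hne : ∀ n, (C n).Nonempty) (hclosed : ∀ n, IsClosed (C n))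
    (hconv : ∀ n, Convex ℝ (C n)) (hbdd : Bornology.IsBounded (C 0)) : (⋂ n, C n).Nonempty := by
  obtain ⟨R, hR⟩ := hbdd.exists_norm_le
  set d : ℕ → ℝ := fun n => sInf (norm '' C n) with hd
  have hbelow : ∀ n, BddBelow (norm '' C n) := fun n =>
    ⟨0, by rintro _ ⟨x, -, rfl⟩; exact norm_nonneg x⟩
  have hd_le : ∀ n, ∀ x ∈ C n, d n ≤ ‖x‖ := fun n x hx => csInf_le (hbelow n) ⟨x, hx, rfl⟩
  have hd_mono : Monotone d := fun m n hmn =>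
    csInf_le_csInf (hbelow m) ((hne n).image _) (Set.image_mono (hanti hmn))
  have hd0 : ∀ n, 0 ≤ d n := fun n =>
    Real.sInf_nonneg (by rintro _ ⟨x, -, rfl⟩; exact norm_nonneg x)
  have hd_bdd : BddAbove (Set.range d) := by
    refine ⟨R, ?_⟩
    rintro _ ⟨n, rfl⟩
    obtain ⟨x, hx⟩ := hne n
    exact (hd_le n x hx).trans (hR x (hanti (Nat.zero_le n) hx))
  set r := ⨆ n, d n with hr
  have hdr : ∀ n, d n ≤ r := le_ciSup hd_bdd
  have hlim : Filter.Tendsto d Filter.atTop (nhds r) := tendsto_atTop_ciSup hd_mono hd_bdd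
  have hx : ∀ n : ℕ, ∃ x ∈ C n, ‖x‖ < d n + 1 / ((n : ℝ) + 1) := by
    intro n
    obtain ⟨_, ⟨x, hx, rfl⟩, h⟩ := exists_lt_of_csInf_lt ((hne n).image norm)
      (lt_add_of_pos_right (d n) (Nat.one_div_pos_of_nat (n := n)))
    exact ⟨x, hx, h⟩
  choose x hxC hxn using hx
  have hcauchy : CauchySeq x := by
    refine Metric.cauchySeq_iff.2 fun ε hε => ?_
    obtain ⟨δ, hδ, h⟩ := exists_forall_norm_le_add_norm_add_le X hε ((hd0 0).trans (hdr 0))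
    have h1 : ∀ᶠ n in Filter.atTop, r - δ < d n :=
      hlim.eventually (lt_mem_nhds (by linarith))
    have h2 : ∀ᶠ n : ℕ in Filter.atTop, 1 / ((n : ℝ) + 1) < δ :=
      tendsto_one_div_add_atTop_nhds_zero_nat.eventually (gt_mem_nhds hδ)
    obtain ⟨N, hN⟩ := Filter.eventually_atTop.1 (h1.and h2)
    -- If `x m` and `x n` were `ε` apart, their midpoint would have norm at most `r - δ < d N`,
    -- although it lies in `C N`.
    refine ⟨N, fun m hm n hn => ?_⟩
    rw [dist_eq_norm]
    by_contra! hge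
    have hsmall := h (x m) (x n) (by linarith [hxn m, hdr m, (hN m hm).2])
      (by linarith [hxn n, hdr n, (hN n hn).2]) hge
    have hmid := hconv N (hanti hm (hxC m)) (hanti hn (hxC n))
      (by norm_num : (0 : ℝ) ≤ 1 / 2) (by norm_num : (0 : ℝ) ≤ 1 / 2) (by norm_num)
    have hlow := hd_le N _ hmid
    rw [← smul_add, norm_smul_of_nonneg (by norm_num)] at hlow
    linarith [(hN N le_rfl).1]
  obtain ⟨y, hy⟩ := cauchySeq_tendsto_of_complete hcauchy
  refine ⟨y, Set.mem_iInter.2 fun n => (hclosed n).mem_of_tendsto hy ?_⟩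
  filter_upwards [Filter.eventually_ge_atTop n] with m hm using hanti hm (hxC m)

/-- A bounded linear functional attains its supremum on a nonempty, closed, convex and bounded
subset of a uniformly convex Banach space. -/
theorem maximizers_nonempty [CompleteSpace X] {C : Set X} (hne : C.Nonempty)
    (hclosed : IsClosed C) (hconv : Convex ℝ C) (hbdd : Bornology.IsBounded C)
    (Φ : StrongDual ℝ X) : (maximizers C Φ).Nonempty := by
  obtain ⟨R, hR⟩ := hbdd.exists_norm_le
  have habove : BddAbove (Φ '' C) := by
    refine ⟨‖Φ‖ * R, ?_⟩
    rintro _ ⟨x, hx, rfl⟩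
    exact (le_abs_self _).trans ((Φ.le_opNorm x).trans (by gcongr; exact hR x hx))
  have hlub := isLUB_csSup (hne.image Φ) habove
  set s := sSup (Φ '' C)
  obtain ⟨y, hy⟩ := nonempty_iInter_of_antitone_of_convex
    (C := fun n : ℕ => C ∩ {x | s - 1 / ((n : ℝ) + 1) ≤ Φ x})
    (fun m n hmn x hx => ⟨hx.1, (sub_le_sub_left (Nat.one_div_le_one_div hmn) s).trans hx.2⟩)
    (fun n => by
      obtain ⟨_, ⟨x, hx, rfl⟩, h, -⟩ := hlub.exists_between
        (sub_lt_self s (Nat.one_div_pos_of_nat (n := n)))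
      exact ⟨x, hx, h.le⟩)
    (fun n => hclosed.inter (isClosed_le continuous_const Φ.continuous))
    (fun n => hconv.inter (convex_halfSpace_ge Φ.toLinearMap.isLinear _))
    (hbdd.subset Set.inter_subset_left)
  rw [Set.mem_iInter] at hy
  have hyC : y ∈ C := (hy 0).1
  have hsy : s ≤ Φ y := by
    have h := tendsto_one_div_add_atTop_nhds_zero_nat (𝕜 := ℝ).const_sub s
    rw [sub_zero] at h
    exact le_of_tendsto' h fun n => (hy n).2
  have : Φ y = s := le_antisymm (hlub.1 ⟨y, hyC, rfl⟩) hsy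
  exact ⟨y, hyC, this ▸ hlub⟩

end UniformlyConvex

/-! ### Maximizers as an intersection of half-spaces -/

section Maximizers

variable {E : Type*} [NormedAddCommGroup E] [NormedSpace ℝ E] {C : Set E}

theorem maximizers_eq_inter_iInter (C : Set E) (Φ : StrongDual ℝ E) :
    maximizers C Φ = C ∩ ⋂ f ∈ C, {g | Φ f ≤ Φ g} := by
  ext g
  simp only [maximizers, Set.mem_ofPred_eq, Set.mem_inter_iff, Set.mem_iInter]
  refine and_congr_right fun hg => ⟨fun h f hf => h.1 ⟨f, hf, rfl⟩, fun h => ⟨?_, ?_⟩⟩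
  · rintro _ ⟨f, hf, rfl⟩
    exact h f hf
  · exact fun b hb => hb ⟨g, hg, rfl⟩

theorem isClosed_maximizers (hclosed : IsClosed C) (Φ : StrongDual ℝ E) :
    IsClosed (maximizers C Φ) := by
  rw [maximizers_eq_inter_iInter]
  exact hclosed.inter <| isClosed_biInter fun f _ => isClosed_le continuous_const Φ.continuous

theorem convex_maximizers (hconv : Convex ℝ C) (Φ : StrongDual ℝ E) :
    Convex ℝ (maximizers C Φ) := by
  rw [maximizers_eq_inter_iInter]
  exact hconv.inter <| convex_iInter₂ fun f _ => convex_halfSpace_ge Φ.toLinearMap.isLinear _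

end Maximizers

/-! ### Uniform convexity of the Bochner space -/

section BochnerSpace

variable {S X : Type*} [MeasurableSpace S] {μ : Measure S} [NormedAddCommGroup X] {p : ℝ≥0∞}

theorem Lp_norm_rpow_eq_integral (hp0 : p ≠ 0) (hp' : p ≠ ∞) (f : Lp X p μ) :
    ‖f‖ ^ p.toReal = ∫ s, ‖f s‖ ^ p.toReal ∂μ := by
  have hI : 0 ≤ ∫ s, ‖f s‖ ^ p.toReal ∂μ := integral_nonneg fun s => by positivity
  rw [Lp.norm_def, (Lp.memLp f).eLpNorm_eq_integral_rpow_norm hp0 hp',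
    ENNReal.toReal_ofReal (by positivity),
    Real.rpow_inv_rpow hI (ENNReal.toReal_pos hp0 hp').ne']

variable [NormedSpace ℝ X] [UniformConvexSpace X]

/-- The inequality in `X` is linear in `p`-th powers of norms and its `K` is the same at every
point, so it integrates unchanged. -/
theorem exists_Lp_norm_sub_rpow_le (μ : Measure S) (hp : 1 < p) (hp' : p < ∞) {ε : ℝ}
    (hε : 0 < ε) :
    ∃ K, 0 < K ∧ ∀ f g : Lp X p μ,
      ‖f - g‖ ^ p.toReal ≤ ε * (‖f‖ ^ p.toReal + ‖g‖ ^ p.toReal) +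
        K * ((‖f‖ ^ p.toReal + ‖g‖ ^ p.toReal) / 2 - ‖f + g‖ ^ p.toReal / 2 ^ p.toReal) := by
  have hp0 : p ≠ 0 := (zero_lt_one.trans hp).ne'
  have hpr : 1 < p.toReal := by
    simpa using (ENNReal.toReal_lt_toReal ENNReal.one_ne_top hp'.ne).2 hp
  obtain ⟨K, hK, h⟩ := exists_norm_sub_rpow_le (X := X) hpr hε
  refine ⟨K, hK, fun f g => ?_⟩
  have hint : ∀ u : Lp X p μ, Integrable (fun s => ‖u s‖ ^ p.toReal) μ := fun u =>
    (Lp.memLp u).integrable_norm_rpow hp0 hp'.ne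
  have hadd : Integrable (fun s => ‖f s‖ ^ p.toReal + ‖g s‖ ^ p.toReal) μ := (hint f).add (hint g)
  have hmean := hadd.div_const 2
  have hmid := (hint (f + g)).div_const (2 ^ p.toReal)
  have hgap := (hmean.sub' hmid).const_mul K
  simp only [Lp_norm_rpow_eq_integral hp0 hp'.ne]
  rw [← integral_add (hint f) (hint g), ← integral_const_mul, ← integral_div, ← integral_div,
    ← integral_sub hmean hmid, ← integral_const_mul, ← integral_add (hadd.const_mul ε) hgap]
  refine integral_mono_ae (hint _) ((hadd.const_mul ε).add hgap) ?_
  filter_upwards [Lp.coeFn_sub f g, Lp.coeFn_add f g] with s h1 h2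
  simp only [h1, h2, Pi.sub_apply, Pi.add_apply]
  exact h (f s) (g s)

/-- **Day's theorem**: for `1 < p < ∞`, the Bochner space `L_p(S; X)` of a uniformly convex space
`X` is uniformly convex. -/
theorem uniformConvexSpace_Lp (μ : Measure S) [Fact (1 ≤ p)] (hp : 1 < p) (hp' : p < ∞) :
    UniformConvexSpace (Lp X p μ) := by
  refine ⟨fun ε hε => ?_⟩
  set P := p.toReal
  have hP : 0 < P := ENNReal.toReal_pos (zero_lt_one.trans hp).ne' hp'.ne
  have hεP : 0 < ε ^ P := Real.rpow_pos_of_pos hε _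
  obtain ⟨K, hK, h⟩ := exists_Lp_norm_sub_rpow_le (X := X) μ hp hp' (ε := ε ^ P / 4)
    (by positivity)
  -- For unit `f`, `g` the inequality reads `ε ^ P ≤ ε ^ P / 2 + K * (1 - (‖f + g‖ / 2) ^ P)`.
  -- Truncating at `0` keeps the `P`-th root meaningful.
  set c := max 0 (1 - ε ^ P / (2 * K)) with hc
  have hc0 : 0 ≤ c := le_max_left _ _
  have hc1 : c < 1 := max_lt one_pos (sub_lt_self _ (by positivity))
  have hcP : c ^ P⁻¹ < 1 := Real.rpow_lt_one hc0 hc1 (by positivity)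
  refine ⟨2 - 2 * c ^ P⁻¹, by linarith, fun f hf g hg hfg => ?_⟩
  have h1 := h f g
  have h2 : ε ^ P ≤ ‖f - g‖ ^ P := Real.rpow_le_rpow hε.le hfg hP.le
  rw [hf, hg, Real.one_rpow, ← Real.div_rpow (norm_nonneg _) zero_le_two] at h1
  have h3 : (‖f + g‖ / 2) ^ P ≤ c := by
    refine le_trans ?_ (le_max_right _ _)
    rw [le_sub_comm, div_le_iff₀ (by positivity)]
    linarith
  have h4 := (Real.le_rpow_inv_iff_of_pos (by positivity) hc0 hP).2 h3
  linarith

theorem bochnerPairing_eq_lpPairing {S X : Type*} [MeasurableSpace S] {μ : Measure S}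
    [NormedAddCommGroup X] [NormedSpace ℝ X] {p q : ℝ≥0∞} [Fact (1 ≤ p)] [Fact (1 ≤ q)]
    [ENNReal.HolderConjugate q p] (φ : Lp (StrongDual ℝ X) q μ) :
    (bochnerPairing φ : Lp X p μ → ℝ) =
      (ContinuousLinearMap.id ℝ (StrongDual ℝ X)).lpPairing μ q p φ := by
  ext f
  rw [ContinuousLinearMap.lpPairing_eq_integral]
  rfl

end BochnerSpace

theorem proposition3p6 {S X : Type*} [MeasurableSpace S] (μ : Measure S) [μ.IsComplete]
    [NormedAddCommGroup X] [NormedSpace ℝ X] [CompleteSpace X]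
    [UniformConvexSpace X] [UniformSmoothSpace X]
    (p q : ℝ≥0∞) [Fact (1 ≤ p)] (hp : 1 < p) (hp' : p < ∞) (hq : 1 < q) (hq' : q < ∞)
    (hpq : p⁻¹ + q⁻¹ = 1)
    (C : Set (Lp X p μ)) (hne : C.Nonempty) (hclosed : IsClosed C) (hconv : Convex ℝ C)
    (hbdd : Bornology.IsBounded C) :
    (∀ φ : Lp (StrongDual ℝ X) q μ,
      solutionSet C φ ⊆ C ∧ (solutionSet C φ).Nonempty ∧ IsClosed (solutionSet C φ) ∧
        Convex ℝ (solutionSet C φ)) ∧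
    (∀ Φ : StrongDual ℝ (Lp X p μ),
      maximizers C Φ ⊆ C ∧ (maximizers C Φ).Nonempty ∧ IsClosed (maximizers C Φ) ∧
        Convex ℝ (maximizers C Φ)) := by

  have := uniformConvexSpace_Lp (X := X) μ hp hp'
  have functional : ∀ Φ : StrongDual ℝ (Lp X p μ),
      maximizers C Φ ⊆ C ∧ (maximizers C Φ).Nonempty ∧ IsClosed (maximizers C Φ) ∧
        Convex ℝ (maximizers C Φ) := fun Φ =>
    ⟨fun _ hg => hg.1, maximizers_nonempty hne hclosed hconv hbdd Φ,
      isClosed_maximizers hclosed Φ, convex_maximizers hconv Φ⟩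
  refine ⟨fun φ => ?_, functional⟩
  have : Fact (1 ≤ q) := ⟨hq.le⟩
  have : ENNReal.HolderConjugate q p := ⟨by rw [inv_one, add_comm, hpq]⟩
  rw [solutionSet, bochnerPairing_eq_lpPairing]
  exact functional _
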